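/- **Definitions.** A cyclically ordered abelian group is an abelian group $G$ with a ternary relation $R$ such that: $R(a,b,c)$ implies that $a,b,c$ are pairwise distinct; $R(a,b,c)$ implies $R(b,c,a)$; for every $c$, $R(c,\cdot,\cdot)$ is a strict linear order on $G\setminus\{c\}$; and $R(a,b,c)$ implies $R(u+a,u+b,u+c)$. Isomorphisms of such groups are group isomorphisms that preserve and reflect $R$. The unwound $\mathrm{uw}(G)$ is the linearly ordered abelian group with underlying set $\mathbb{Z}\times G$, addition $(m,a)+(n,b)=(m+n+\varepsilon(a,b),a+b)$, where $\varepsilon(a,b)=0$ if $a=0$ or $b=0$ or $R(0,a,a+b)$, and $\varepsilon(a,b)=1$ otherwise, and order $(m,a)<(n,b)$ iff $m<n$, or $m=n$ and ($R(0,a,b)$ or $a=0\neq b$). The linear part $l(G)$ is the image under $(n,g)\mapsto g$ of the greatest proper convex subgroup of $\mathrm{uw}(G)$, and $G$ is c-archimedean if $l(G)=\{0\}$. $G$ is discrete if it has a first positive element, i.e. an element $1_G\neq 0$ such that $R(0,x,1_G)$ holds for no $x\in G$; this element is then unique. If $G$ is discrete and not c-archimedean, $G/\langle 1_G\rangle$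 carries the cyclic order for which three pairwise distinct classes are in relation iff they have representatives $a,b,c$ with $R(a,b,c)$. $\mathbb{U}$ denotes the group of all complex roots of unity, cyclically ordered by their arguments in $[0,2\pi)$: $R$ holds iff the arguments are strictly increasing up to a cyclic permutation. For a prime $p$, $n\geq 1$ and $0\leq k<p^n$, $D_{p^n,k}$ is the first-order sentence $$\exists x,\quad R(0,x,2x,\dots,(p^n-1)x)\ \wedge\ p^n x=k\,1_G ,$$ where $R(x_1,\dots,x_m)$ means that the $x_i$ are pairwise distinct and $R(x_i,x_j,x_l)$ holds for all $i<j<l$ (for $p^n=2$ it means $x\neq 0$), and where $1_G$ is replaced by its first-order definition. A characteristic sequence of $G$ is a family $(\varphi_p)_{p\text{ prime}}$ of maps $\varphi_p:\mathbb{N}^*\to\{0,\dots,p-1\}$ such that, for all $p$, $n\ge 1$ and $0\le k<p^n$, $D_{p^n,k}$ holds in $G$ iff $k=\varphi_p(1)+\varphi_p(2)p+\cdots+\varphi_p(n)p^{n-1}$. **Proposition.** Let $C_1$ and $C_2$ be discrete cyclically ordered abelian groups that are not c-archimedean and such that $C_1/\langle 1_{C_1}\rangle\simeq\mathbb{U}\simeq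 C_2/\langle 1_{C_2}\rangle$ as cyclically ordered groups. Then each of $C_1$, $C_2$ has exactly one characteristic sequence, and the following conditions are equivalent: 1. $C_1$ and $C_2$ are isomorphic (as cyclically ordered groups); 2. for every prime $p$, every $n\ge 1$ and every $0\le k<p^n$, $D_{p^n,k}$ holds in $C_1$ iff it holds in $C_2$; 3. $C_1$ and $C_2$ are elementarily equivalent in the language $(+,-,0,R)$ of cyclically ordered groups; 4. the characteristic sequence of $C_1$ is equal to the characteristic sequence of $C_2$. -/

import Mathlib

open scoped FirstOrder

namespace CyclicOrd

/-! ### Cyclically ordered abelian groups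

The strict ternary relation `R` of a cyclically ordered group is Mathlib's `sbtw`. -/

/-- An abelian group with a cyclic order that is compatible with translations. -/
class CyclicallyOrderedAddGroup (G : Type*) [AddCommGroup G] [CircularOrder G] : Prop where
  sbtw_add_left : ∀ u a b c : G, sbtw a b c → sbtw (u + a) (u + b) (u + c)

/-- Two abelian groups with ternary relations are isomorphic: there is a group isomorphism that
preserves and reflects the relation. -/
def IsoWith {A B : Type*} [AddGroup A] [AddGroup B] (RA : A → A → A → Prop)
    (RB : B → B → B → Prop) : Prop :=
  ∃ f : A ≃+ B, ∀ a b c : A, RA a b c ↔ RB (f a) (f b) (f c)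

/-- Isomorphism of cyclically ordered abelian groups. -/
def Isomorphic (G H : Type*) [AddCommGroup G] [CircularOrder G] [AddCommGroup H]
    [CircularOrder H] : Prop :=
  IsoWith (fun a b c : G => sbtw a b c) (fun a b c : H => sbtw a b c)

/-! ### The unwound and the linear part -/

/-- The strict linear order on `G` with least element `0` that is given by `R(0, ·, ·)`. -/
def CutLT {G : Type*} [AddCommGroup G] [CircularOrder G] (a b : G) : Prop :=
  (a = 0 ∧ b ≠ 0) ∨ sbtw 0 a b

theorem sbtw_or_of_ne {G : Type*} [CircularOrder G] {a b c : G} (h₁ : a ≠ b) (h₂ : b ≠ c)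
    (h₃ : c ≠ a) : sbtw a b c ∨ sbtw c b a := by
  by_cases h : sbtw a b c
  · exact Or.inl h
  · refine Or.inr (sbtw_iff_not_btw.2 fun h' => ?_)
    have h'' : btw c b a := by
      by_contra hh
      exact h (sbtw_iff_not_btw.2 hh)
    rcases h'.antisymm h'' with h | h | h
    · exact h₁ h
    · exact h₂ h
    · exact h₃ h

section CutLT

variable {G : Type*} [AddCommGroup G] [CircularOrder G]

theorem cutLT_irrefl (a : G) : ¬ CutLT a a := by
  rintro (⟨h, h'⟩ | h)
  · exact h' h
  · exact sbtw_irrefl_right h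

theorem cutLT_trans {a b c : G} (h : CutLT a b) (h' : CutLT b c) : CutLT a c := by
  rcases h with ⟨rfl, hb⟩ | h <;> rcases h' with ⟨rfl, hc⟩ | h'
  · exact absurd rfl hb
  · refine Or.inl ⟨rfl, ?_⟩
    rintro rfl
    exact sbtw_irrefl_left_right h'
  · exact absurd h sbtw_irrefl_left_right
  · exact Or.inr (h.trans_right h')

theorem cutLT_trichotomy (a b : G) : CutLT a b ∨ a = b ∨ CutLT b a := by
  by_cases hab : a = b
  · exact Or.inr (Or.inl hab)
  by_cases ha : a = 0
  · exact Or.inl (Or.inl ⟨ha, fun hb => hab (ha.trans hb.symm)⟩)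
  by_cases hb : b = 0
  · exact Or.inr (Or.inr (Or.inl ⟨hb, ha⟩))
  rcases sbtw_or_of_ne (a := (0 : G)) (Ne.symm ha) hab hb with h | h
  · exact Or.inl (Or.inr h)
  · exact Or.inr (Or.inr (Or.inr h.cyclic_right))

theorem sbtw_of_cutLT {a b c : G} (h : CutLT a b) (h' : CutLT b c) : sbtw a b c := by
  rcases h with ⟨rfl, hb⟩ | h <;> rcases h' with ⟨rfl, hc⟩ | h'
  · exact absurd rfl hb
  · exact h'
  · exact absurd h sbtw_irrefl_left_right
  · exact (h'.cyclic_left.trans_right h.cyclic_right).cyclic_right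

theorem sbtw_iff_cutLT (a b c : G) : sbtw a b c ↔
    (CutLT a b ∧ CutLT b c) ∨ (CutLT b c ∧ CutLT c a) ∨ (CutLT c a ∧ CutLT a b) := by
  constructor
  · intro h
    have hab : a ≠ b := fun e => sbtw_irrefl_left (e ▸ h)
    have hbc : b ≠ c := fun e => sbtw_irrefl_right (e ▸ h)
    have hca : c ≠ a := fun e => sbtw_irrefl_left_right (e ▸ h)
    have n₁ : CutLT c b → ¬ CutLT b a := fun h₁ h₂ => h.not_sbtw (sbtw_of_cutLT h₁ h₂)
    have n₂ : CutLT b a → ¬ CutLT a c := fun h₁ h₂ =>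
      h.not_sbtw (sbtw_of_cutLT h₁ h₂).cyclic_right
    have n₃ : CutLT a c → ¬ CutLT c b := fun h₁ h₂ =>
      h.not_sbtw (sbtw_of_cutLT h₁ h₂).cyclic_left
    have t₁ := cutLT_trichotomy a b
    have t₂ := cutLT_trichotomy b c
    have t₃ := cutLT_trichotomy c a
    tauto
  · rintro (⟨h, h'⟩ | ⟨h, h'⟩ | ⟨h, h'⟩)
    · exact sbtw_of_cutLT h h'
    · exact (sbtw_of_cutLT h h').cyclic_right
    · exact (sbtw_of_cutLT h h').cyclic_left

end CutLT

/-- The unwound `uw(G)` of a cyclically ordered group: the set `ℤ × G` with the group law and the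
order defined below. -/
@[ext]
structure Unwound (G : Type*) where
  turns : ℤ
  elt : G

namespace Unwound

open Classical in
/-- The number of additional turns in the sum of two elements `a` and `b` of `G`: it is `0` if
`a = 0`, if `b = 0` or if `R(0, a, a + b)`, and `1` if `R(0, a + b, a)` or `a + b = 0 ≠ a`. -/
noncomputable def carry {G : Type*} [AddCommGroup G] [CircularOrder G] (a b : G) : ℤ :=
  if a = 0 ∨ b = 0 ∨ sbtw 0 a (a + b) then 0 else 1

section

variable {G : Type*} [AddCommGroup G] [CircularOrder G]

open Classical in
theorem carry_eq (a b : G) : carry a b = if CutLT (a + b) a then 1 else 0 := by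
  unfold carry
  by_cases ha : a = 0
  · subst ha
    have : ¬ CutLT (0 + b) 0 := by
      rintro (⟨h, h'⟩ | h)
      · exact h' rfl
      · exact sbtw_irrefl_left_right h
    rw [if_pos (Or.inl rfl), if_neg this]
  by_cases hb : b = 0
  · subst hb
    have : ¬ CutLT (a + 0) a := by
      rw [add_zero]
      exact cutLT_irrefl a
    rw [if_pos (Or.inr (Or.inl rfl)), if_neg this]
  by_cases h : sbtw 0 a (a + b)
  · rw [if_pos (Or.inr (Or.inr h)), if_neg]
    exact fun h' => cutLT_irrefl _ (cutLT_trans h' (Or.inr h))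
  · rw [if_neg (by tauto), if_pos]
    rcases cutLT_trichotomy (a + b) a with h' | h' | h'
    · exact h'
    · exact absurd (by simpa using h') hb
    · rcases h' with h' | h'
      · exact absurd h'.1 ha
      · exact absurd h' h

theorem carry_zero_left (a : G) : carry 0 a = 0 := if_pos (Or.inl rfl)

/-- The group law `(m, a) + (n, b) = (m + n + carry a b, a + b)`. -/
noncomputable instance : Add (Unwound G) := ⟨fun x y => ⟨x.turns + y.turns + carry x.elt y.elt, x.elt + y.elt⟩⟩

instance : Zero (Unwound G) := ⟨⟨0, 0⟩⟩

noncomputable instance : Neg (Unwound G) := ⟨fun x => ⟨-x.turns - carry (-x.elt) x.elt, -x.elt⟩⟩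

variable [CyclicallyOrderedAddGroup G]

theorem sbtw_add_left_iff (u a b c : G) : sbtw (u + a) (u + b) (u + c) ↔ sbtw a b c := by
  refine ⟨fun h => ?_, CyclicallyOrderedAddGroup.sbtw_add_left u a b c⟩
  simpa using CyclicallyOrderedAddGroup.sbtw_add_left (-u) _ _ _ h

theorem sbtw_zero_neg {x y : G} (h : sbtw 0 x y) : sbtw 0 (-y) (-x) := by
  have key : ∀ {x y : G}, sbtw 0 x y → sbtw 0 (y - x) (-x) ∧ sbtw 0 (-y) (x - y) := by
    intro x y h
    have h₁ := CyclicallyOrderedAddGroup.sbtw_add_left (-x) _ _ _ h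
    have h₂ := CyclicallyOrderedAddGroup.sbtw_add_left (-y) _ _ _ h
    simp only [add_zero, neg_add_cancel, neg_add_eq_sub] at h₁ h₂
    exact ⟨h₁.cyclic_left, h₂.cyclic_right⟩
  have hx : x ≠ 0 := fun e => sbtw_irrefl_left (e ▸ h)
  have hy : y ≠ 0 := fun e => sbtw_irrefl_left_right (e ▸ h)
  have hxy : x ≠ y := fun e => sbtw_irrefl_right (e ▸ h)
  rcases sbtw_or_of_ne (a := (0 : G)) (b := -y) (c := -x) (by simpa using hy)
    (by simpa using hxy.symm) (by simpa using hx) with h' | h'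
  · exact h'
  · exfalso
    have h'' := h'.cyclic_right
    have k₁ := key h
    have k₂ := key h''
    simp only [neg_neg, sub_neg_eq_add, neg_add_eq_sub] at k₂
    have e₁ := h.trans_right k₂.2
    have e₂ := (e₁.trans_right k₁.1).trans_right h''
    exact sbtw_irrefl_right ((e₂.trans_right k₁.2).trans_right k₂.1)

theorem carry_comm (a b : G) : carry a b = carry b a := by
  have key : ∀ a b : G, sbtw 0 a (a + b) → sbtw 0 b (b + a) := by
    intro a b h
    have h₁ := CyclicallyOrderedAddGroup.sbtw_add_left (a + b) _ _ _ (sbtw_zero_neg h)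
    rw [add_zero, add_neg_cancel, add_neg_cancel_comm] at h₁
    rw [add_comm b a]
    exact h₁.cyclic_left
  unfold carry
  congr 1
  have h₁ := key a b
  have h₂ := key b a
  exact propext (by tauto)

theorem carry_assoc (a b c : G) :
    carry a b + carry (a + b) c = carry b c + carry a (b + c) := by
  classical
  have hbc : CutLT (b + c) b ↔
      (a + (b + c) = a ∧ a + b ≠ a) ∨ sbtw a (a + (b + c)) (a + b) := by
    have := sbtw_add_left_iff a 0 (b + c) b
    rw [add_zero] at this
    rw [this]
    simp [CutLT]
  simp only [carry_eq, hbc, sbtw_iff_cutLT, add_assoc]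
  generalize a + (b + c) = w
  generalize a + b = z
  have t₁ := cutLT_trichotomy a z
  have t₂ := cutLT_trichotomy a w
  have t₃ := cutLT_trichotomy z w
  have i₁ := cutLT_irrefl (G := G)
  have i₂ := @cutLT_trans G _ _
  grind

noncomputable instance : AddCommGroup (Unwound G) where
  nsmul := nsmulRec
  zsmul := zsmulRec
  add_assoc x y z := by
    have h := carry_assoc x.elt y.elt z.elt
    refine Unwound.ext ?_ (add_assoc x.elt y.elt z.elt)
    change x.turns + y.turns + carry x.elt y.elt + z.turns + carry (x.elt + y.elt) z.elt =
      x.turns + (y.turns + z.turns + carry y.elt z.elt) + carry x.elt (y.elt + z.elt)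
    linarith
  zero_add x := by
    refine Unwound.ext ?_ (zero_add x.elt)
    change 0 + x.turns + carry 0 x.elt = x.turns
    rw [carry_zero_left]
    ring
  add_zero x := by
    refine Unwound.ext ?_ (add_zero x.elt)
    change x.turns + 0 + carry x.elt 0 = x.turns
    rw [carry_comm, carry_zero_left]
    ring
  neg_add_cancel x := by
    refine Unwound.ext ?_ (neg_add_cancel x.elt)
    change -x.turns - carry (-x.elt) x.elt + x.turns + carry (-x.elt) x.elt = 0
    ring
  add_comm x y := by
    refine Unwound.ext ?_ (add_comm x.elt y.elt)
    change x.turns + y.turns + carry x.elt y.elt = y.turns + x.turns + carry y.elt x.elt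
    rw [carry_comm x.elt y.elt]
    ring

/-- The order: `(m, a) < (n, b)` if `m < n`, or `m = n` and `R(0, a, b)`, or `m = n` and
`a = 0 ≠ b`. -/
instance : PartialOrder (Unwound G) where
  lt x y := x.turns < y.turns ∨ (x.turns = y.turns ∧ CutLT x.elt y.elt)
  le x y := x = y ∨ x.turns < y.turns ∨ (x.turns = y.turns ∧ CutLT x.elt y.elt)
  le_refl x := Or.inl rfl
  le_trans x y z h h' := by
    rcases h with rfl | h
    · exact h'
    · rcases h' with rfl | h'
      · exact Or.inr h
      · refine Or.inr ?_
        rcases h with h | ⟨h, k⟩ <;> rcases h' with h' | ⟨h', k'⟩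
        · exact Or.inl (h.trans h')
        · exact Or.inl (h.trans_eq h')
        · exact Or.inl (h.trans_lt h')
        · exact Or.inr ⟨h.trans h', cutLT_trans k k'⟩
  le_antisymm x y h h' := by
    rcases h with rfl | h
    · rfl
    · rcases h' with rfl | h'
      · rfl
      · exfalso
        rcases h with h | ⟨h, k⟩ <;> rcases h' with h' | ⟨h', k'⟩
        · omega
        · omega
        · omega
        · exact cutLT_irrefl _ (cutLT_trans k k')
  lt_iff_le_not_ge x y := by
    constructor
    · intro h
      refine ⟨Or.inr h, ?_⟩
      rintro (rfl | h')
      · rcases h with h | ⟨h, k⟩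
        · omega
        · exact cutLT_irrefl _ k
      · rcases h with h | ⟨h, k⟩ <;> rcases h' with h' | ⟨h', k'⟩
        · omega
        · omega
        · omega
        · exact cutLT_irrefl _ (cutLT_trans k k')
    · rintro ⟨rfl | h, h'⟩
      · exact absurd (Or.inl rfl) h'
      · exact h

/-- The projection of the unwound onto `G`, whose kernel is generated by `z_G = (1, 0)`. -/
def proj (G : Type*) [AddCommGroup G] [CircularOrder G] [CyclicallyOrderedAddGroup G] :
    Unwound G →+ G where
  toFun := elt
  map_zero' := rfl
  map_add' _ _ := rfl

end

end Unwound

section Definitions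

variable (G : Type*) [AddCommGroup G] [CircularOrder G]

/-- The linear part `l(G)`: the image in `G` of the greatest proper convex subgroup of the unwound
(the supremum of all proper convex subgroups, which form a chain). -/
noncomputable def linearPart [CyclicallyOrderedAddGroup G] : AddSubgroup G :=
  (sSup {H : AddSubgroup (Unwound G) | (H : Set (Unwound G)).OrdConnected ∧ H ≠ ⊤}).map
    (Unwound.proj G)

/-- `G` is c-archimedean if its linear part is trivial. -/
def CArchimedean [CyclicallyOrderedAddGroup G] : Prop := linearPart G = ⊥

variable {G}

/-- `e` is the first positive element `1_G` of `G`: it is nonzero and no element lies strictly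
between `0` and `e`. It is unique if it exists, and `G` is discrete if it exists. -/
def IsFirstPositive (e : G) : Prop := e ≠ 0 ∧ ∀ x : G, ¬ sbtw 0 x e

theorem IsFirstPositive.unique {e e' : G} (h : IsFirstPositive e) (h' : IsFirstPositive e') :
    e = e' := by
  rcases cutLT_trichotomy e e' with (k | k) | k | (k | k)
  · exact absurd k.1 h.1
  · exact absurd k (h'.2 e)
  · exact k
  · exact absurd k.1 h'.1
  · exact absurd k (h.2 e')

/-- The cyclic order that `G` induces on the quotient by a subgroup `H` (which is meant to be
c-convex): `R(x, y, z)` holds if `x, y, z` are pairwise distinct and have representatives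
`a, b, c` with `R(a, b, c)`. -/
def quotientSBtw (H : AddSubgroup G) (x y z : G ⧸ H) : Prop :=
  x ≠ y ∧ y ≠ z ∧ z ≠ x ∧ ∃ a b c : G, (a : G ⧸ H) = x ∧ (b : G ⧸ H) = y ∧ (c : G ⧸ H) = z ∧
    sbtw a b c

/-- `R(x_0, …, x_{m-1})` for a finite sequence: the terms are pairwise distinct and
`R(x_i, x_j, x_l)` holds for all `i < j < l`. -/
def CyclicChain {m : ℕ} (x : Fin m → G) : Prop :=
  (∀ i j, i < j → x i ≠ x j) ∧ ∀ i j l, i < j → j < l → sbtw (x i) (x j) (x l)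

end Definitions

/-! ### The cyclically ordered group of roots of unity -/

/-- The argument in `[0, 2π)` of a complex number of modulus one. -/
noncomputable def circleArg (z : Circle) : ℝ :=
  toIcoMod Real.two_pi_pos 0 (Complex.arg (z : ℂ))

/-- The group `𝕌` of all complex roots of unity, written additively. -/
abbrev RootsOfOne : Type := Additive (CommGroup.torsion Circle)

/-- The cyclic order of `𝕌`: `R(x, y, z)` holds if the arguments in `[0, 2π)` of `x, y, z` are
increasing, up to a cyclic permutation. -/
def rootsSBtw (x y z : RootsOfOne) : Prop :=
  let t : RootsOfOne → ℝ := fun w => circleArg (Additive.toMul w).val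
  (t x < t y ∧ t y < t z) ∨ (t y < t z ∧ t z < t x) ∨ (t z < t x ∧ t x < t y)

/-! ### The first-order language of cyclically ordered groups -/

/-- The function symbols `+`, `-`, `0`. -/
inductive CogFunc : ℕ → Type
  | add : CogFunc 2
  | neg : CogFunc 1
  | zero : CogFunc 0

/-- The ternary relation symbol `R`. -/
inductive CogRel : ℕ → Type
  | R : CogRel 3

/-- The first-order language `(+, -, 0, R)` of cyclically ordered groups. -/
def cogLanguage : FirstOrder.Language := ⟨CogFunc, CogRel⟩

instance cogStructure (G : Type*) [AddCommGroup G] [CircularOrder G] : cogLanguage.Structure G where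
  funMap {_} f := match f with
    | CogFunc.add => fun v => v 0 + v 1
    | CogFunc.neg => fun v => - v 0
    | CogFunc.zero => fun _ => 0
  RelMap {_} r := match r with
    | CogRel.R => fun v => sbtw (v 0) (v 1) (v 2)

section Formulas

open FirstOrder Language

variable {α : Type}

/-- The term `0`. -/
def zeroTerm : cogLanguage.Term α := Term.func (L := cogLanguage) CogFunc.zero ![]

/-- The term `n t = t + ⋯ + t`. -/
def nsmulTerm (t : cogLanguage.Term α) : ℕ → cogLanguage.Term α
  | 0 => zeroTerm
  | n + 1 => Term.func (L := cogLanguage) CogFunc.add ![nsmulTerm t n, t]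

/-- The atomic formula `R(t₁, t₂, t₃)`. -/
def formulaR {n : ℕ} (t₁ t₂ t₃ : cogLanguage.Term (α ⊕ Fin n)) : cogLanguage.BoundedFormula α n :=
  Relations.boundedFormula (L := cogLanguage) CogRel.R ![t₁, t₂, t₃]

/-- The formula saying that the variable `&0` is the first positive element. -/
def firstPositiveFormula : cogLanguage.BoundedFormula Empty 2 :=
  ∼(&0 =' zeroTerm) ⊓ ∀' ∼(formulaR zeroTerm &2 &0)

/-- The formula `R(0, x, 2x, …, (m - 1) x)` in the variable `x = &1`. -/
noncomputable def chainFormula (m : ℕ) : cogLanguage.BoundedFormula Empty 2 :=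
  BoundedFormula.iInf (fun q : {q : Fin m × Fin m // q.1 < q.2} =>
      ∼(nsmulTerm &1 q.1.1 =' nsmulTerm &1 q.1.2)) ⊓
    BoundedFormula.iInf (fun q : {q : Fin m × Fin m × Fin m // q.1 < q.2.1 ∧ q.2.1 < q.2.2} =>
      formulaR (nsmulTerm &1 q.1.1) (nsmulTerm &1 q.1.2.1) (nsmulTerm &1 q.1.2.2))

/-- The first-order sentence `D_{m,k}`: `∃ x, R(0, x, 2x, …, (m - 1) x) ∧ m x = k 1_G`, where
`1_G = &0` is given by its definition. -/
noncomputable def sentenceD (m k : ℕ) : cogLanguage.Sentence :=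
  ∃' ∃' (firstPositiveFormula ⊓ (chainFormula m ⊓ (nsmulTerm &1 m =' nsmulTerm &0 k)))

end Formulas

section Realize

open FirstOrder Language

variable {G : Type*} [AddCommGroup G] [CircularOrder G] {α : Type}

theorem realize_zeroTerm (v : α → G) : (zeroTerm : cogLanguage.Term α).realize v = 0 := rfl

theorem realize_nsmulTerm (v : α → G) (t : cogLanguage.Term α) (n : ℕ) :
    (nsmulTerm t n).realize v = n • t.realize v := by
  induction n with
  | zero => rw [zero_smul]; rfl
  | succ n ih => rw [succ_nsmul, ← ih]; rfl

theorem realize_formulaR {n : ℕ} (t₁ t₂ t₃ : cogLanguage.Term (α ⊕ Fin n)) (v : α → G)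
    (w : Fin n → G) : (formulaR t₁ t₂ t₃).Realize v w ↔
      sbtw (t₁.realize (Sum.elim v w)) (t₂.realize (Sum.elim v w))
        (t₃.realize (Sum.elim v w)) := Iff.rfl

/-- The sentence `D_{m,k}` has the intended meaning. -/
theorem realize_sentenceD (m k : ℕ) : G ⊨ sentenceD m k ↔
    ∃ e x : G, IsFirstPositive e ∧ CyclicChain (fun i : Fin m => (i : ℕ) • x) ∧
      m • x = k • e := by
  simp [sentenceD, Sentence.Realize, Formula.Realize, firstPositiveFormula, chainFormula,
    realize_nsmulTerm, realize_formulaR, realize_zeroTerm, IsFirstPositive, CyclicChain,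
    Fin.snoc, and_assoc]

end Realize

/-! ### Characteristic sequences -/

/-- Families of maps `φ_p : ℕ* → {0, …, p - 1}`, where `p` runs over the primes. -/
abbrev DigitSequence : Type := (p : Nat.Primes) → ℕ+ → Fin (p : ℕ)

section CharSeq

open FirstOrder Language

variable (G : Type*) [AddCommGroup G] [CircularOrder G]

/-- `φ` is a characteristic sequence of `G`: for all `p`, `n ≥ 1` and `0 ≤ k < p ^ n`, the sentence
`D_{p^n,k}` holds in `G` if and only if `k = φ_p(1) + φ_p(2) p + ⋯ + φ_p(n) p ^ (n - 1)`. -/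
def IsCharSeq (φ : DigitSequence) : Prop :=
  ∀ (p : Nat.Primes) (n : ℕ), 1 ≤ n → ∀ k : ℕ, k < (p : ℕ) ^ n →
    (G ⊨ sentenceD ((p : ℕ) ^ n) k ↔
      k = ∑ i ∈ Finset.range n, (φ p i.succPNat : ℕ) * (p : ℕ) ^ i)

instance : Nonempty DigitSequence := ⟨fun p _ => ⟨0, p.2.pos⟩⟩

/-- The characteristic sequence of `G` (arbitrary if `G` has none). -/
noncomputable def charSeq : DigitSequence := Classical.epsilon (IsCharSeq G)

end CharSeq

end CyclicOrd

namespace CyclicOrd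

/-! ### Arguments of roots of unity -/

/-! The hypothesis gives a surjection `f` of `C` onto the roots of unity with kernel generated by `e
= 1_C`. Since `e` is first positive, all its multiples lie in order before any element outside the
kernel, so the kernel is a copy of `ℤ`. The cyclic order is then determined by `f`: distinct images
are compared among the roots of unity, and inside a coset the multiples of `e` are compared as
integers.

A lift `x` of `exp (2πi / N)` satisfies `N x = k e`, and another lift changes `k` by a multiple of
`N` (`modEq_of_nsmul_eq`). These residues modulo `N`, compatible along divisibility, are the class
of `C` as an extension of the roots of unity by `ℤ`. The sentence `D_{p^n,k}` says exactly that the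
residue at `p^n` is `k` (`realize_sentenceD_iff`), because its chain condition forces the witness to
lie over `exp (2πi / p^n)`. The residues at the powers of `p` form a `p`-adic integer, whose digits
are the characteristic sequence.

By the Chinese remainder principle, equal residues at prime powers give equal residues at every `N`
(`exists_zeta_lifts`). Lifts with equal residues are matched, and this extends uniquely to an
isomorphism (`IsRootsProj.isomorphic`). -/

theorem circleArg_mem (z : Circle) : circleArg z ∈ Set.Ico 0 (2 * Real.pi) := by
  have := toIcoMod_mem_Ico Real.two_pi_pos 0 (Complex.arg (z : ℂ))
  rwa [zero_add] at this

theorem exp_circleArg (z : Circle) : Circle.exp (circleArg z) = z := by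
  obtain ⟨_, k, hk⟩ := (toIcoMod_eq_iff Real.two_pi_pos (a := 0)
    (b := Complex.arg (z : ℂ)) (c := circleArg z)).1 rfl
  conv_rhs => rw [← Circle.exp_arg z, hk]
  rw [Circle.exp_eq_exp]
  exact ⟨-k, by simp⟩

theorem circleArg_exp {t : ℝ} (ht : t ∈ Set.Ico 0 (2 * Real.pi)) :
    circleArg (Circle.exp t) = t :=
  Circle.exp_injOn_Ico (a := 0) (b := 2 * Real.pi) (by simp) (circleArg_mem _) ht
    (exp_circleArg _)

/-- The argument in `[0, 2π)` of a root of unity. -/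
noncomputable def rootArg (w : RootsOfOne) : ℝ := circleArg (Additive.toMul w).val

theorem rootArg_injective : Function.Injective rootArg := fun v w h => by
  have h' : (Additive.toMul v).val = (Additive.toMul w).val := by
    rw [← exp_circleArg (Additive.toMul v).val, ← exp_circleArg (Additive.toMul w).val]
    exact congrArg _ h
  exact Additive.toMul.injective (Subtype.ext h')

theorem rootArg_zero : rootArg 0 = 0 := by
  have := circleArg_exp (t := 0) ⟨le_rfl, Real.two_pi_pos⟩
  rwa [Circle.exp_zero] at this

theorem rootArg_pos {w : RootsOfOne} (hw : w ≠ 0) : 0 < rootArg w :=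
  lt_of_le_of_ne (circleArg_mem _).1 fun h => hw (rootArg_injective (h.symm.trans rootArg_zero.symm))

theorem rootsSBtw_iff (x y z : RootsOfOne) : rootsSBtw x y z ↔
    (rootArg x < rootArg y ∧ rootArg y < rootArg z) ∨
      (rootArg y < rootArg z ∧ rootArg z < rootArg x) ∨
      (rootArg z < rootArg x ∧ rootArg x < rootArg y) := Iff.rfl

theorem rootsSBtw.not_rev {x y z : RootsOfOne} (h : rootsSBtw x y z) : ¬ rootsSBtw z y x := by
  rw [rootsSBtw_iff] at *
  grind

/-- The root of unity `exp (2πi / N)`. -/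
noncomputable def zeta (N : ℕ) [NeZero N] : RootsOfOne :=
  Additive.ofMul ⟨Circle.exp (2 * Real.pi / N), by
    rw [CommGroup.mem_torsion, isOfFinOrder_iff_pow_eq_one]
    refine ⟨N, NeZero.pos N, ?_⟩
    rw [← Circle.exp_nsmul, nsmul_eq_mul, mul_div_cancel₀ _ (NeZero.ne _), Circle.exp_two_pi]⟩

theorem nsmul_zeta_val (N m : ℕ) [NeZero N] :
    (Additive.toMul (m • zeta N)).val = Circle.exp (2 * Real.pi * m / N) := by
  change Circle.exp (2 * Real.pi / N) ^ m = _
  rw [← Circle.exp_nsmul, nsmul_eq_mul]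
  congr 1
  ring

theorem nsmul_zeta_self (N : ℕ) [NeZero N] : N • zeta N = 0 := by
  refine Additive.toMul.injective (Subtype.ext ?_)
  rw [nsmul_zeta_val, mul_div_cancel_right₀ _ (NeZero.ne _), Circle.exp_two_pi]
  rfl

theorem nsmul_zeta_mul (N M : ℕ) [NeZero N] [NeZero M] : M • zeta (N * M) = zeta N := by
  refine Additive.toMul.injective (Subtype.ext ?_)
  rw [← one_nsmul (zeta N), nsmul_zeta_val, nsmul_zeta_val]
  congr 1
  have : (M : ℝ) ≠ 0 := NeZero.ne _
  push_cast
  field_simp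

theorem rootArg_nsmul_zeta {N m : ℕ} [NeZero N] (hm : m < N) :
    rootArg (m • zeta N) = 2 * Real.pi * m / N := by
  rw [rootArg, nsmul_zeta_val]
  refine circleArg_exp ⟨by positivity, ?_⟩
  have : (0 : ℝ) < N := by exact_mod_cast NeZero.pos N
  rw [div_lt_iff₀ this]
  exact mul_lt_mul_of_pos_left (by exact_mod_cast hm) Real.two_pi_pos

theorem rootArg_nsmul_zeta_lt {N m n : ℕ} [NeZero N] (hmn : m < n) (hn : n < N) :
    rootArg (m • zeta N) < rootArg (n • zeta N) := by
  rw [rootArg_nsmul_zeta hn, rootArg_nsmul_zeta (hmn.trans hn)]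
  have : (0 : ℝ) < N := by exact_mod_cast NeZero.pos N
  have := Real.pi_pos
  gcongr

theorem exists_eq_nsmul_zeta {N : ℕ} [NeZero N] {w : RootsOfOne} (hw : N • w = 0) :
    ∃ m < N, w = m • zeta N := by
  have hN : (0 : ℝ) < N := by exact_mod_cast NeZero.pos N
  have h : Circle.exp (N * rootArg w) = 1 := by
    rw [← nsmul_eq_mul, Circle.exp_nsmul, rootArg, exp_circleArg]
    exact congrArg (fun v : RootsOfOne => (Additive.toMul v).val) hw
  obtain ⟨m, hm⟩ := Circle.exp_eq_one.1 h
  obtain ⟨h0, h1⟩ : rootArg w ∈ Set.Ico 0 (2 * Real.pi) := circleArg_mem _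
  have hpi := Real.two_pi_pos
  have hm0 : 0 ≤ m := by
    have : (0 : ℝ) ≤ m := nonneg_of_mul_nonneg_left (hm ▸ mul_nonneg hN.le h0) hpi
    exact_mod_cast this
  lift m to ℕ using hm0
  have hmN : m < N := by
    have : (m : ℝ) * (2 * Real.pi) < N * (2 * Real.pi) := by
      have := mul_lt_mul_of_pos_left h1 hN
      rw [hm] at this
      exact_mod_cast this
    exact_mod_cast lt_of_mul_lt_mul_right this hpi.le
  refine ⟨m, hmN, rootArg_injective ?_⟩
  rw [rootArg_nsmul_zeta hmN, eq_div_iff hN.ne', mul_comm, hm, mul_comm]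
  simp

theorem exists_nsmul_eq_zero (w : RootsOfOne) : ∃ N : ℕ, 0 < N ∧ N • w = 0 := by
  obtain ⟨N, hN, h⟩ := isOfFinOrder_iff_pow_eq_one.1
    ((CommGroup.mem_torsion _).1 (Additive.toMul w).2)
  exact ⟨N, hN, Additive.toMul.injective (Subtype.ext h)⟩

/-- A root of unity of order `N` whose first `N` multiples have increasing arguments is
`exp (2πi / N)`. -/
theorem eq_zeta_of_rootArg_lt {N : ℕ} [NeZero N] (hN : 2 ≤ N) {w : RootsOfOne} (hw : N • w = 0)
    (hord : ∀ d, 0 < d → d < N → d • w ≠ 0)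
    (hlt : ∀ i j, 0 < i → i < j → j < N → rootArg (i • w) < rootArg (j • w)) : w = zeta N := by
  classical
  have hinj : Set.InjOn (fun i : ℕ => i • w) (Finset.range N) := by
    have : ∀ i j : ℕ, i < j → j < N → i • w ≠ j • w := fun i j hij hj h => by
      refine hord (j - i) (by omega) (by omega) ?_
      rw [sub_nsmul w hij.le, h, add_neg_cancel]
    intro i hi j hj h
    simp only [Finset.coe_range, Set.mem_Iio] at hi hj
    rcases lt_trichotomy i j with h' | h' | h'
    · exact absurd h (this i j h' hj)
    · exact h'
    · exact absurd h.symm (this j i h' hi)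
  have hzinj : Set.InjOn (fun i : ℕ => i • zeta N) (Finset.range N) := by
    intro i hi j hj h
    simp only [Finset.coe_range, Set.mem_Iio] at hi hj
    rcases lt_trichotomy i j with h' | h' | h'
    · exact absurd (congrArg rootArg h) (rootArg_nsmul_zeta_lt h' hj).ne
    · exact h'
    · exact absurd (congrArg rootArg h) (rootArg_nsmul_zeta_lt h' hi).ne'
  have hsub : (Finset.range N).image (fun i : ℕ => i • w) ⊆
      (Finset.range N).image (fun i : ℕ => i • zeta N) := by
    intro v hv
    obtain ⟨i, hi, rfl⟩ := Finset.mem_image.1 hv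
    obtain ⟨m, hm, h⟩ := exists_eq_nsmul_zeta (N := N) (w := i • w)
      (by rw [smul_comm, hw, smul_zero])
    exact Finset.mem_image.2 ⟨m, Finset.mem_range.2 hm, h.symm⟩
  have heq := Finset.eq_of_subset_of_card_le hsub (by
    rw [Finset.card_image_of_injOn hinj, Finset.card_image_of_injOn hzinj])
  -- The multiples of `w` exhaust the `N`-th roots of unity, so `zeta N = i • w`. If `1 < i`, then
  -- `w` would be a nonzero `N`-th root with argument below that of `zeta N`, which has the least
  -- positive one.
  obtain ⟨i, hi, h⟩ := Finset.mem_image.1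
    (heq ▸ Finset.mem_image.2 ⟨1, Finset.mem_range.2 hN, rfl⟩ :
      (1 : ℕ) • zeta N ∈ (Finset.range N).image (fun i : ℕ => i • w))
  rw [Finset.mem_range] at hi
  simp only [one_nsmul] at h
  obtain ⟨m, hm, hwm⟩ := exists_eq_nsmul_zeta hw
  have hi0 : i ≠ 0 := by
    rintro rfl
    rw [zero_nsmul] at h
    have := rootArg_nsmul_zeta_lt (N := N) (m := 0) (n := 1) one_pos hN
    rw [zero_nsmul, one_nsmul, ← h] at this
    exact this.false
  rcases Nat.lt_or_ge 1 i with h1 | h1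
  · have := hlt 1 i one_pos h1 hi
    rw [h, one_nsmul, hwm] at this
    rcases Nat.lt_trichotomy m 1 with h' | rfl | h'
    · obtain rfl : m = 0 := by omega
      exact absurd (by simpa using hwm) (by simpa using hord 1 one_pos hN)
    · rw [one_nsmul] at this
      exact absurd this (lt_irrefl _)
    · have h2 := rootArg_nsmul_zeta_lt h' hm
      rw [one_nsmul] at h2
      exact absurd this h2.not_gt
  · obtain rfl : i = 1 := by omega
    simpa using h

end CyclicOrd

namespace CyclicOrd

/-! ### Extensions of the roots of unity by a first positive element -/

/-- `f` is a surjection of `C` onto the roots of unity whose kernel is generated by `e`, and which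
detects the cyclic order of elements with distinct images. -/
structure IsRootsProj {C : Type*} [AddCommGroup C] [CircularOrder C] (e : C)
    (f : C →+ RootsOfOne) : Prop where
  firstPositive : IsFirstPositive e
  surjective : Function.Surjective f
  map_eq_zero_iff : ∀ x, f x = 0 ↔ ∃ k : ℤ, x = k • e
  sbtw_iff : ∀ a b c, f a ≠ f b → f b ≠ f c → f c ≠ f a →
    (sbtw a b c ↔ rootsSBtw (f a) (f b) (f c))

/-- The quotient relation only promises some related representatives, whereas `sbtw_iff` concerns
arbitrary ones. The converse direction follows from totality in `C`: a reversed triple would map to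
a reversed triple of roots. -/
theorem exists_isRootsProj {C : Type*} [AddCommGroup C] [CircularOrder C] {e : C}
    (he : IsFirstPositive e)
    (hU : IsoWith (quotientSBtw (AddSubgroup.zmultiples e)) rootsSBtw) :
    ∃ f : C →+ RootsOfOne, IsRootsProj e f := by
  obtain ⟨F, hF⟩ := hU
  refine ⟨F.toAddMonoidHom.comp (QuotientAddGroup.mk' (AddSubgroup.zmultiples e)), he, ?_, ?_, ?_⟩
  · exact F.surjective.comp (QuotientAddGroup.mk'_surjective _)
  · intro x
    change F (x : C ⧸ AddSubgroup.zmultiples e) = 0 ↔ _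
    rw [F.map_eq_zero_iff, QuotientAddGroup.eq_zero_iff, AddSubgroup.mem_zmultiples_iff]
    simp only [eq_comm]
  · have key : ∀ a b c : C, F a ≠ F b → F b ≠ F c → F c ≠ F a → sbtw a b c →
        rootsSBtw (F a) (F b) (F c) := fun a b c hab hbc hca h =>
      (hF _ _ _).1 ⟨fun h => hab (congrArg F h), fun h => hbc (congrArg F h),
        fun h => hca (congrArg F h), a, b, c, rfl, rfl, rfl, h⟩
    intro a b c hab hbc hca
    change F a ≠ F b at hab
    change F b ≠ F c at hbc
    change F c ≠ F a at hca
    refine ⟨key a b c hab hbc hca, fun h => ?_⟩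
    rcases sbtw_or_of_ne (a := a) (b := b) (c := c) (by rintro rfl; exact hab rfl)
      (by rintro rfl; exact hbc rfl) (by rintro rfl; exact hca rfl) with h' | h'
    · exact h'
    · exact absurd (key c b a hbc.symm hab.symm hca.symm h') h.not_rev

namespace IsRootsProj

variable {C : Type*} [AddCommGroup C] [CircularOrder C] {e : C} {f : C →+ RootsOfOne}

theorem map_eq_iff (h : IsRootsProj e f) (x y : C) : f x = f y ↔ ∃ k : ℤ, y = x + k • e := by
  rw [eq_comm, ← sub_eq_zero, ← map_sub, h.map_eq_zero_iff]
  simp only [sub_eq_iff_eq_add']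

theorem map_self (h : IsRootsProj e f) : f e = 0 := (h.map_eq_zero_iff e).2 ⟨1, by simp⟩

theorem map_add_zsmul (h : IsRootsProj e f) (x : C) (k : ℤ) : f (x + k • e) = f x := by
  simp [h.map_self]

theorem exists_map_ne_zero (h : IsRootsProj e f) : ∃ x, f x ≠ 0 := by
  obtain ⟨x, hx⟩ := h.surjective (zeta 2)
  refine ⟨x, fun h0 => ?_⟩
  have := rootArg_nsmul_zeta_lt (N := 2) (m := 0) (n := 1) one_pos one_lt_two
  rw [zero_nsmul, one_nsmul, ← hx, h0] at this
  exact this.false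

theorem exists_zeta_lift (h : IsRootsProj e f) (N : ℕ) [NeZero N] :
    ∃ k < N, ∃ x, f x = zeta N ∧ N • x = k • e := by
  obtain ⟨y, hy⟩ := h.surjective (zeta N)
  obtain ⟨k, hk⟩ := (h.map_eq_zero_iff (N • y)).1 (by rw [map_nsmul, hy, nsmul_zeta_self])
  have hN : (0 : ℤ) < N := by exact_mod_cast NeZero.pos N
  -- Moving the lift by `-(k / N)` times `e` subtracts `N * (k / N)` from `k`.
  refine ⟨(k % N).toNat, by have := Int.emod_lt_of_pos k hN; omega, y + (-(k / N)) • e,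
    by rw [h.map_add_zsmul, hy], ?_⟩
  rw [← natCast_zsmul _ (k % N).toNat, Int.toNat_of_nonneg (Int.emod_nonneg k hN.ne'), nsmul_add,
    hk, ← natCast_zsmul (_ • e), smul_smul, ← add_zsmul, Int.emod_def]
  congr 1
  ring

theorem cyclicChain_of_map_eq_zeta (h : IsRootsProj e f) {N : ℕ} [NeZero N] {x : C}
    (hx : f x = zeta N) : CyclicChain (fun i : Fin N => (i : ℕ) • x) := by
  have hlt : ∀ i j : Fin N, i < j → rootArg (f ((i : ℕ) • x)) < rootArg (f ((j : ℕ) • x)) :=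
    fun i j hij => by
      rw [map_nsmul, map_nsmul, hx]
      exact rootArg_nsmul_zeta_lt hij j.2
  have hne : ∀ i j : Fin N, i < j → f ((i : ℕ) • x) ≠ f ((j : ℕ) • x) := fun i j hij he =>
    (hlt i j hij).ne (congrArg rootArg he)
  refine ⟨fun i j hij he => hne i j hij (congrArg f he), fun i j l hij hjl => ?_⟩
  refine (h.sbtw_iff _ _ _ (hne i j hij) (hne j l hjl) (hne i l (hij.trans hjl)).symm).2 ?_
  exact Or.inl ⟨hlt i j hij, hlt j l hjl⟩

/-! ### The order on the kernel and on its cosets -/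

variable [CyclicallyOrderedAddGroup C]

/-- Nothing lies between `0` and `e`, so `e` precedes every element outside the kernel; translation
by `k • e` does the rest. -/
theorem sbtw_succ (h : IsRootsProj e f) {x : C} (hx : f x ≠ 0) (k : ℤ) :
    sbtw (k • e) ((k + 1) • e) x := by
  have key : ∀ y : C, f y ≠ 0 → sbtw 0 e y := fun y hy => by
    have h0 : y ≠ 0 := by rintro rfl; exact hy (map_zero f)
    have h1 : e ≠ y := by rintro rfl; exact hy h.map_self
    rcases sbtw_or_of_ne (a := (0 : C)) h.firstPositive.1.symm h1 h0 with h' | h'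
    · exact h'
    · exact absurd h'.cyclic_right (h.firstPositive.2 y)
  have := CyclicallyOrderedAddGroup.sbtw_add_left (k • e) _ _ _
    (key (x + (-k) • e) (by rwa [h.map_add_zsmul]))
  rwa [add_zero, ← add_one_zsmul, add_comm x, ← add_assoc, ← add_zsmul, add_neg_cancel, zero_zsmul,
    zero_add] at this

theorem sbtw_zsmul_of_lt (h : IsRootsProj e f) {x : C} (hx : f x ≠ 0) {k l : ℤ} (hkl : k < l) :
    sbtw (k • e) (l • e) x := by
  induction l, hkl using Int.leInduction with
  | base => exact h.sbtw_succ hx k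
  | succ l _ ih =>
    exact (ih.cyclic_right.trans_right (h.sbtw_succ hx l).cyclic_right).cyclic_left

theorem sbtw_add_zsmul (h : IsRootsProj e f) {a c : C} (hac : f a ≠ f c) {k : ℤ} (hk : 0 < k) :
    sbtw a (a + k • e) c := by
  have hx : f (c - a) ≠ 0 := by rwa [map_sub, sub_ne_zero, ne_comm]
  simpa using CyclicallyOrderedAddGroup.sbtw_add_left a _ _ _ (h.sbtw_zsmul_of_lt hx hk)

/-- A point outside the kernel serves as a common endpoint after all multiples of `e`. -/
theorem sbtw_zsmul_zsmul (h : IsRootsProj e f) {i j l : ℤ} (hij : i < j) (hjl : j < l) :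
    sbtw (i • e) (j • e) (l • e) := by
  obtain ⟨x, hx⟩ := h.exists_map_ne_zero
  exact ((h.sbtw_zsmul_of_lt hx hjl).cyclic_left.trans_left
    (h.sbtw_zsmul_of_lt hx hij).cyclic_right).cyclic_left

theorem zsmul_injective (h : IsRootsProj e f) : Function.Injective fun k : ℤ => k • e := by
  obtain ⟨x, hx⟩ := h.exists_map_ne_zero
  have key : ∀ k l : ℤ, k < l → k • e ≠ l • e := fun k l hkl he => by
    have := h.sbtw_zsmul_of_lt hx hkl
    rw [he] at this
    exact sbtw_irrefl_left this
  intro k l he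
  rcases lt_trichotomy k l with h' | h' | h'
  · exact absurd he (key k l h')
  · exact h'
  · exact absurd he.symm (key l k h')

/-- Elements with the same image differ by some `j • e`, so their `N`-th multiples differ by `(N *
j) • e`; coefficients are unique by `zsmul_injective`. The residue modulo `N` is thus an invariant
of the image. -/
theorem modEq_of_nsmul_eq (h : IsRootsProj e f) {x y : C} (hxy : f x = f y) {N : ℕ} {k l : ℤ}
    (hx : N • x = k • e) (hy : N • y = l • e) : k ≡ l [ZMOD N] := by
  obtain ⟨j, rfl⟩ := (h.map_eq_iff x y).1 hxy
  refine (Int.modEq_iff_dvd).2 ⟨j, ?_⟩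
  refine h.zsmul_injective ?_
  change (l - k) • e = ((N : ℤ) * j) • e
  rw [sub_zsmul, ← hx, ← hy, nsmul_add, ← natCast_zsmul (j • e), smul_smul, add_neg_cancel_comm]

/-! ### The meaning of the sentences `D_{N,k}` -/

theorem not_sbtw_zero_nsmul (h : IsRootsProj e f) {x : C} (hx : f x ≠ 0) (k : ℕ) :
    ¬ sbtw 0 x (k • e) := by
  rcases Nat.eq_zero_or_pos k with rfl | hk
  · rw [zero_nsmul]
    exact sbtw_irrefl_left_right
  · intro h'
    have := h.sbtw_zsmul_of_lt hx (k := 0) (l := k) (by exact_mod_cast hk)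
    rw [zero_zsmul, natCast_zsmul] at this
    exact h'.not_sbtw this.cyclic_left

theorem map_eq_zeta_of_cyclicChain (h : IsRootsProj e f) {N k : ℕ} [NeZero N] (hN : 2 ≤ N)
    (hk : k < N) {x : C} (hc : CyclicChain (fun i : Fin N => (i : ℕ) • x)) (hx : N • x = k • e) :
    f x = zeta N := by
  have hz : N • f x = 0 := by rw [← map_nsmul, hx, map_nsmul, h.map_self, smul_zero]
  have h0 : ∀ j, 0 < j → j < N → j • x ≠ 0 := fun j hj hjN he =>
    hc.1 ⟨0, by omega⟩ ⟨j, hjN⟩ hj (by simp [he])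
  have hs : ∀ i j, 0 < i → i < j → j < N → sbtw 0 (i • x) (j • x) := fun i j hi hij hj => by
    simpa using hc.2 ⟨0, by omega⟩ ⟨i, by omega⟩ ⟨j, hj⟩ hi hij
  have hord : ∀ d, 0 < d → d < N → d • f x ≠ 0 := by
    intro d hd hdN hdx
    -- Suppose `f x` has order `m < N`, with `N = m * q`. Then `m • x = i • e` with `q * i = k`, so
    -- `0 ≤ i`.
    have hpos : 0 < addOrderOf (f x) :=
      Nat.pos_of_dvd_of_pos (addOrderOf_dvd_of_nsmul_eq_zero hz) (NeZero.pos N)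
    have hmN : addOrderOf (f x) < N :=
      (Nat.le_of_dvd hd (addOrderOf_dvd_of_nsmul_eq_zero hdx)).trans_lt hdN
    obtain ⟨q, hq⟩ := addOrderOf_dvd_of_nsmul_eq_zero hz
    have hm0 := addOrderOf_nsmul_eq_zero (f x)
    generalize addOrderOf (f x) = m at hpos hmN hq hm0
    obtain ⟨i, hi⟩ := (h.map_eq_zero_iff (m • x)).1 (by rw [map_nsmul, hm0])
    have hqi : (q : ℤ) * i = k := h.zsmul_injective (by
      change ((q : ℤ) * i) • e = (k : ℤ) • e
      rw [mul_smul, ← hi, natCast_zsmul, natCast_zsmul, smul_smul, mul_comm, ← hq, hx])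
    have hi0 : 0 ≤ i := by
      have : 0 < q := Nat.pos_of_ne_zero (by rintro rfl; omega)
      by_contra hneg
      have := mul_neg_of_pos_of_neg (Int.natCast_pos.2 this) (not_le.1 hneg)
      omega
    lift i to ℕ using hi0
    rw [natCast_zsmul] at hi
    -- For `1 < m` the chain would put `x` between `0` and `i • e`, though `x` is outside the
    -- kernel. For `m = 1`, `N * i = k < N` forces `i = 0`, hence `x = 0`.
    rcases Nat.lt_or_ge 1 m with h1 | h1
    · have hfx : f x ≠ 0 := by
        intro hfx
        obtain ⟨l, hl⟩ := (h.map_eq_zero_iff x).1 hfx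
        have hNl : (N : ℤ) * l = k := h.zsmul_injective (by
          change ((N : ℤ) * l) • e = (k : ℤ) • e
          rw [mul_smul, ← hl, natCast_zsmul, natCast_zsmul, hx])
        have hl0 : l = 0 := by
          have h3 : 0 ≤ l := by nlinarith
          have h4 : l < 1 := by nlinarith
          omega
        exact h0 1 one_pos hN (by simp [hl, hl0])
      have := hs 1 m one_pos h1 hmN
      rw [one_nsmul, hi] at this
      exact h.not_sbtw_zero_nsmul hfx i this
    · obtain rfl : m = 1 := by omega
      rw [one_mul] at hq
      subst hq
      have hi1 : i = 0 := by
        have : N * i = k := by exact_mod_cast hqi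
        rcases Nat.eq_zero_or_pos i with h' | h'
        · exact h'
        · have := Nat.le_mul_of_pos_right N h'
          omega
      exact h0 1 one_pos hmN (by simp [hi, hi1])
  refine eq_zeta_of_rootArg_lt hN hz hord fun i j hi hij hj => ?_
  have hfi : f (i • x) ≠ 0 := by rw [map_nsmul]; exact hord i hi (hij.trans hj)
  have hfj : f (j • x) ≠ 0 := by rw [map_nsmul]; exact hord j (hi.trans hij) hj
  have hfij : f (i • x) ≠ f (j • x) := fun he => hord (j - i) (by omega) (by omega) (by
    rw [sub_nsmul _ hij.le, ← map_nsmul, ← map_nsmul, he, add_neg_cancel])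
  have := (h.sbtw_iff 0 (i • x) (j • x) (by rw [map_zero]; exact hfi.symm) hfij
    (by rw [map_zero]; exact hfj)).1 (hs i j hi hij hj)
  rw [rootsSBtw_iff, map_zero, rootArg_zero] at this
  have h3 := rootArg_pos hfi
  have h4 := rootArg_pos hfj
  rw [map_nsmul, map_nsmul] at *
  rcases this with h' | h' | h'
  · exact h'.2
  · exact h'.1
  · exact absurd h'.1 h4.not_gt

open FirstOrder Language in
theorem realize_sentenceD_iff (h : IsRootsProj e f) {N k : ℕ} [NeZero N] (hN : 2 ≤ N)
    (hk : k < N) : C ⊨ sentenceD N k ↔ ∃ x, f x = zeta N ∧ N • x = k • e := by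
  rw [realize_sentenceD]
  constructor
  · rintro ⟨e', x, he', hc, hx⟩
    obtain rfl := he'.unique h.firstPositive
    exact ⟨x, h.map_eq_zeta_of_cyclicChain hN hk hc hx, hx⟩
  · rintro ⟨x, hfx, hx⟩
    exact ⟨e, x, h.firstPositive, h.cyclicChain_of_map_eq_zeta hfx, hx⟩

end IsRootsProj
end CyclicOrd

namespace CyclicOrd

/-! ### Characteristic sequences of extensions of the roots of unity -/

namespace IsRootsProj

open FirstOrder Language

variable {C : Type*} [AddCommGroup C] [CircularOrder C] [CyclicallyOrderedAddGroup C] {e : C}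
  {f : C →+ RootsOfOne}

theorem realize_sentenceD_iff_eq (h : IsRootsProj e f) {N k l : ℕ} [NeZero N] (hN : 2 ≤ N)
    (hk : k < N) (hl : l < N) {x : C} (hfx : f x = zeta N) (hx : N • x = l • e) :
    C ⊨ sentenceD N k ↔ k = l := by
  rw [h.realize_sentenceD_iff hN hk]
  constructor
  · rintro ⟨y, hfy, hy⟩
    have := h.modEq_of_nsmul_eq (hfy.trans hfx.symm) (k := k) (l := l) (by simpa using hy)
      (by simpa using hx)
    exact ((Int.natCast_modEq_iff.1 this).eq_of_lt_of_lt hk hl)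
  · rintro rfl
    exact ⟨x, hfx, hx⟩

theorem existsUnique_isCharSeq (h : IsRootsProj e f) : ∃! φ : DigitSequence, IsCharSeq C φ := by
  -- `r N` will be the residue of `C` at `N`; its value at `N = 0` is arbitrary.
  have hr : ∀ N : ℕ, ∃ k : ℕ, N ≠ 0 → k < N ∧ ∀ [NeZero N], ∃ x, f x = zeta N ∧ N • x = k • e := by
    intro N
    by_cases hN : N = 0
    · exact ⟨0, fun h' => absurd hN h'⟩
    · have : NeZero N := ⟨hN⟩
      obtain ⟨k, hk, hx⟩ := h.exists_zeta_lift N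
      exact ⟨k, fun _ => ⟨hk, hx⟩⟩
  choose r hr using hr
  have hpow : ∀ (p : Nat.Primes) (n : ℕ), (p : ℕ) ^ n ≠ 0 := fun p n =>
    pow_ne_zero n p.2.ne_zero
  have hiff : ∀ φ : DigitSequence, IsCharSeq C φ ↔ ∀ (p : Nat.Primes) (n : ℕ),
      r ((p : ℕ) ^ n) = ∑ i ∈ Finset.range n, (φ p i.succPNat : ℕ) * (p : ℕ) ^ i := by
    intro φ
    have hD : ∀ (p : Nat.Primes) (n : ℕ), 1 ≤ n → ∀ k : ℕ, k < (p : ℕ) ^ n →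
        (C ⊨ sentenceD ((p : ℕ) ^ n) k ↔ k = r ((p : ℕ) ^ n)) := by
      intro p n hn k hk
      have : NeZero ((p : ℕ) ^ n) := ⟨hpow p n⟩
      obtain ⟨hlt, hx⟩ := hr _ (hpow p n)
      obtain ⟨x, hfx, hx⟩ := hx
      exact h.realize_sentenceD_iff_eq (p.2.two_le.trans (Nat.le_self_pow (by omega) _)) hk hlt
        hfx hx
    constructor
    · intro hφ p n
      -- `IsCharSeq` starts at `n = 1`; at `n = 0` the bound `r 1 < 1` matches the empty sum.
      rcases Nat.eq_zero_or_pos n with rfl | hn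
      · have := (hr _ (hpow p 0)).1
        simp only [pow_zero] at this
        simp only [pow_zero, Finset.range_zero, Finset.sum_empty]
        omega
      · have hlt := (hr _ (hpow p n)).1
        exact (hφ p n hn _ hlt).1 ((hD p n hn _ hlt).2 rfl)
    · intro hφ p n hn k hk
      rw [hD p n hn k hk, hφ p n]
  -- If `y` lifts `zeta (p ^ (n + 1))`, then `p • y` lifts `zeta (p ^ n)` with the same coefficient
  -- of `e`, so the residues are coherent.
  have hmod : ∀ (p : Nat.Primes) (n : ℕ),
      r ((p : ℕ) ^ (n + 1)) % (p : ℕ) ^ n = r ((p : ℕ) ^ n) := by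
    intro p n
    have i₁ : NeZero ((p : ℕ) ^ n) := ⟨hpow p n⟩
    have i₂ : NeZero (p : ℕ) := ⟨p.2.ne_zero⟩
    obtain ⟨hlt, hx⟩ := hr _ (hpow p n)
    obtain ⟨x, hfx, hx⟩ := hx
    obtain ⟨hlt', hy⟩ := hr _ (hpow p (n + 1))
    rw [pow_succ] at hy hlt' ⊢
    obtain ⟨y, hfy, hy⟩ := hy
    have := h.modEq_of_nsmul_eq (x := (p : ℕ) • y) (y := x)
      (by rw [map_nsmul, hfy, nsmul_zeta_mul, hfx]) (N := (p : ℕ) ^ n)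
      (k := r ((p : ℕ) ^ n * p)) (l := r ((p : ℕ) ^ n))
      (by rw [smul_smul, hy, natCast_zsmul]) (by rw [hx, natCast_zsmul])
    rw [Int.natCast_modEq_iff] at this
    exact Eq.trans this (Nat.mod_eq_of_lt hlt)
  -- Sequences are indexed from `1`, so `φ p i` is the digit of `p ^ (i - 1)`, the leading base-`p`
  -- digit allowed in `r (p ^ i)`.
  refine ⟨fun p i => ⟨r ((p : ℕ) ^ (i.natPred + 1)) / (p : ℕ) ^ i.natPred, ?_⟩, ?_, ?_⟩
  · rw [Nat.div_lt_iff_lt_mul (Nat.pos_of_ne_zero (hpow p _)), ← pow_succ']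
    exact (hr _ (hpow p _)).1
  · refine (hiff _).2 fun p n => ?_
    induction n with
    | zero =>
      have := (hr _ (hpow p 0)).1
      simp only [pow_zero] at this
      simp only [pow_zero, Finset.range_zero, Finset.sum_empty]
      omega
    | succ n ih =>
      rw [Finset.sum_range_succ, ← ih, ← hmod p n]
      simp only [Nat.natPred_succPNat]
      exact (Nat.mod_add_div' _ _).symm
  · intro φ hφ
    funext p i
    refine Fin.ext ?_
    have h₁ := (hiff φ).1 hφ p i.natPred
    have h₂ := (hiff φ).1 hφ p (i.natPred + 1)
    rw [Finset.sum_range_succ, ← h₁, ← hmod p i.natPred, PNat.succPNat_natPred] at h₂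
    have h₃ := Nat.mod_add_div' (r ((p : ℕ) ^ (i.natPred + 1))) ((p : ℕ) ^ i.natPred)
    exact (Nat.eq_of_mul_eq_mul_right (Nat.pos_of_ne_zero (hpow p i.natPred))
      (Nat.add_left_cancel (h₃.trans h₂))).symm

end IsRootsProj

/-! ### The isomorphism between two extensions with the same residues -/

section Iso

variable {A B : Type*} [AddCommGroup A] [CircularOrder A] [CyclicallyOrderedAddGroup A]
  [AddCommGroup B] [CircularOrder B] [CyclicallyOrderedAddGroup B]
  {a₀ : A} {b₀ : B} {f : A →+ RootsOfOne} {g : B →+ RootsOfOne}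

/-- `a` and `b` lie over the same root of unity, and they have a multiple `k a₀`, respectively
`k b₀`, with the same factor and the same `k`. -/
def Matches (a₀ : A) (b₀ : B) (f : A →+ RootsOfOne) (g : B →+ RootsOfOne) (a : A) (b : B) : Prop :=
  f a = g b ∧ ∃ N : ℕ, 0 < N ∧ ∃ k : ℤ, N • a = k • a₀ ∧ N • b = k • b₀

omit [CircularOrder A] [CyclicallyOrderedAddGroup A] [CircularOrder B]
  [CyclicallyOrderedAddGroup B] in
theorem Matches.symm {a : A} {b : B} (h : Matches a₀ b₀ f g a b) : Matches b₀ a₀ g f b a := by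
  obtain ⟨h, N, hN, k, h₁, h₂⟩ := h
  exact ⟨h.symm, N, hN, k, h₂, h₁⟩

omit [CircularOrder A] [CyclicallyOrderedAddGroup A] [CircularOrder B]
  [CyclicallyOrderedAddGroup B] in
theorem Matches.add {a a' : A} {b b' : B} (h : Matches a₀ b₀ f g a b)
    (h' : Matches a₀ b₀ f g a' b') : Matches a₀ b₀ f g (a + a') (b + b') := by
  obtain ⟨h, N, hN, k, h₁, h₂⟩ := h
  obtain ⟨h', M, hM, l, h₁', h₂'⟩ := h'
  refine ⟨by rw [map_add, map_add, h, h'], N * M, Nat.mul_pos hN hM, M * k + N * l, ?_, ?_⟩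
  · rw [nsmul_add, mul_nsmul, h₁, mul_nsmul', h₁', add_zsmul, mul_smul, mul_smul, natCast_zsmul,
      natCast_zsmul]
  · rw [nsmul_add, mul_nsmul, h₂, mul_nsmul', h₂', add_zsmul, mul_smul, mul_smul, natCast_zsmul,
      natCast_zsmul]

omit [CircularOrder A] [CyclicallyOrderedAddGroup A] [CircularOrder B]
  [CyclicallyOrderedAddGroup B] in
theorem Matches.zsmul {a : A} {b : B} (h : Matches a₀ b₀ f g a b) (m : ℤ) :
    Matches a₀ b₀ f g (m • a) (m • b) := by
  obtain ⟨h, N, hN, k, h₁, h₂⟩ := h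
  exact ⟨by rw [map_zsmul, map_zsmul, h], N, hN, m * k, by rw [smul_comm, h₁, smul_smul],
    by rw [smul_comm, h₂, smul_smul]⟩

omit [CyclicallyOrderedAddGroup A] [CyclicallyOrderedAddGroup B] in
theorem IsRootsProj.matches_self (hf : IsRootsProj a₀ f) (hg : IsRootsProj b₀ g) :
    Matches a₀ b₀ f g a₀ b₀ :=
  ⟨hf.map_self.trans hg.map_self.symm, 1, one_pos, 1, by simp, by simp⟩

omit [CircularOrder A] [CyclicallyOrderedAddGroup A] in
-- Two matches differ by `j • b₀`. Comparing coefficients of the `N * M`-th multiple in `A` gives `M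
-- * k = N * l`, and in `B` this leaves `N * M * j = 0`.
theorem Matches.unique (hg : IsRootsProj b₀ g) {a : A} {b b' : B}
    (hinj : Function.Injective fun k : ℤ => k • a₀) (h : Matches a₀ b₀ f g a b) (h' : Matches a₀ b₀ f g a b') : b = b' := by
  obtain ⟨h, N, hN, k, h₁, h₂⟩ := h
  obtain ⟨h', M, hM, l, h₁', h₂'⟩ := h'
  obtain ⟨j, rfl⟩ := (hg.map_eq_iff b b').1 (h.symm.trans h')
  have hkl : (M : ℤ) * k = N * l := hinj (by
    change ((M : ℤ) * k) • a₀ = ((N : ℤ) * l) • a₀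
    rw [mul_smul, ← h₁, mul_smul, ← h₁', natCast_zsmul, natCast_zsmul, smul_comm])
  have hj : (N : ℤ) * l = M * k + (N * M) * j := hg.zsmul_injective (by
    change ((N : ℤ) * l) • b₀ = ((M : ℤ) * k + (N * M) * j) • b₀
    rw [mul_smul, ← h₂', add_zsmul, mul_smul, ← h₂, mul_smul, mul_smul]
    simp only [natCast_zsmul, nsmul_add]
    rw [smul_comm M N b])
  have hj0 : ((N : ℤ) * M) * j = 0 := by omega
  rcases mul_eq_zero.1 hj0 with h0 | rfl
  · exact absurd h0 (by positivity)
  · simp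

/-- A homomorphism over the roots of unity that respects first positive elements keeps all data
determining the order. The cases are the possible coincidences among the three images. -/
theorem IsRootsProj.sbtw_map (hf : IsRootsProj a₀ f) (hg : IsRootsProj b₀ g) {F : A →+ B}
    (hF : ∀ a, g (F a) = f a) (hF₀ : F a₀ = b₀) {a b c : A} (h : sbtw a b c) :
    sbtw (F a) (F b) (F c) := by
  have hadd : ∀ (a : A) (k : ℤ), F (a + k • a₀) = F a + k • b₀ := fun a k => by
    rw [map_add, map_zsmul, hF₀]
  -- With `a` and `b = a + k • a₀` in one coset and `c` outside, the relation forces `0 < k`. Other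
  -- positions of the coinciding pair are rotations of this one.
  have two : ∀ {a b c : A}, sbtw a b c → f a = f b → f a ≠ f c →
      sbtw (F a) (F b) (F c) := by
    intro a b c h hab hac
    obtain ⟨k, rfl⟩ := (hf.map_eq_iff a b).1 hab
    rcases lt_trichotomy k 0 with hk | rfl | hk
    · have := hf.sbtw_add_zsmul (a := a + k • a₀) (fun h' => hac (hab.trans h')) (neg_pos.2 hk)
      rw [neg_zsmul, add_neg_cancel_right] at this
      exact absurd this.cyclic_right h.not_sbtw
    · exact absurd h (by simpa using sbtw_irrefl_left)
    · rw [hadd]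
      exact hg.sbtw_add_zsmul (by rwa [hF, hF]) hk
  by_cases hab : f a = f b
  · by_cases hac : f a = f c
    · obtain ⟨i, rfl⟩ := (hf.map_eq_iff a b).1 hab
      obtain ⟨j, rfl⟩ := (hf.map_eq_iff a c).1 hac
      have h' : sbtw ((0 : ℤ) • a₀) (i • a₀) (j • a₀) := by
        refine (Unwound.sbtw_add_left_iff a _ _ _).1 ?_
        simpa using h
      have : sbtw ((0 : ℤ) • b₀) (i • b₀) (j • b₀) := by
        have h0i : (0 : ℤ) ≠ i := by rintro rfl; exact sbtw_irrefl_left h'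
        have hij : i ≠ j := by rintro rfl; exact sbtw_irrefl_right h'
        have h0j : (0 : ℤ) ≠ j := by rintro rfl; exact sbtw_irrefl_left_right h'
        -- Of the eight sign patterns, two are inconsistent, three are the rotations of `0 < i < j`,
        -- and three reverse the orientation of `h'`.
        rcases lt_or_gt_of_ne h0i with h1 | h1 <;> rcases lt_or_gt_of_ne hij with h2 | h2 <;>
          rcases lt_or_gt_of_ne h0j with h3 | h3
        · exact hg.sbtw_zsmul_zsmul h1 h2
        · omega
        · exact absurd (hf.sbtw_zsmul_zsmul h3 h2).cyclic_left h'.not_sbtw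
        · exact (hg.sbtw_zsmul_zsmul h3 h1).cyclic_left
        · exact absurd (hf.sbtw_zsmul_zsmul h1 h3).cyclic_right h'.not_sbtw
        · exact (hg.sbtw_zsmul_zsmul h2 h3).cyclic_right
        · omega
        · exact absurd (hf.sbtw_zsmul_zsmul h2 h1) h'.not_sbtw
      rw [hadd, hadd]
      simpa using (Unwound.sbtw_add_left_iff (F a) _ _ _).2 this
    · exact two h hab hac
  · by_cases hbc : f b = f c
    · exact (two h.cyclic_left hbc (fun h' => hab h'.symm)).cyclic_right
    · by_cases hca : f c = f a
      · exact (two h.cyclic_right hca (fun h' => hbc h'.symm)).cyclic_left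
      · refine (hg.sbtw_iff _ _ _ ?_ ?_ ?_).2 ?_ <;> simp only [hF]
        exacts [hab, hbc, hca, (hf.sbtw_iff _ _ _ hab hbc hca).1 h]

/-! ### Construction of the isomorphism -/

omit [CyclicallyOrderedAddGroup A] [CyclicallyOrderedAddGroup B] in
-- Every `a` has the form `m • x + j • a₀` with `x` over some `zeta N`, and matching is additive.
theorem IsRootsProj.exists_matches (hf : IsRootsProj a₀ f) (hg : IsRootsProj b₀ g)
    (hz : ∀ (N : ℕ) [NeZero N], ∃ (k : ℕ) (x : A) (y : B),
      f x = zeta N ∧ N • x = k • a₀ ∧ g y = zeta N ∧ N • y = k • b₀) (a : A) :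
    ∃ b, Matches a₀ b₀ f g a b := by
  obtain ⟨N, hN, ha⟩ := exists_nsmul_eq_zero (f a)
  have : NeZero N := ⟨hN.ne'⟩
  obtain ⟨m, _, hm⟩ := exists_eq_nsmul_zeta ha
  obtain ⟨k, x, y, hfx, hx, hgy, hy⟩ := hz N
  have hxy : Matches a₀ b₀ f g x y :=
    ⟨hfx.trans hgy.symm, N, hN, k, by rw [hx, natCast_zsmul], by rw [hy, natCast_zsmul]⟩
  obtain ⟨j, rfl⟩ := (hf.map_eq_iff ((m : ℤ) • x) a).1 (by rw [map_zsmul, hfx, hm, natCast_zsmul])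
  exact ⟨_, (hxy.zsmul m).add ((hf.matches_self hg).zsmul j)⟩

/-- Uniqueness of matches makes the chosen maps additive and mutually inverse. -/
theorem IsRootsProj.isomorphic (hf : IsRootsProj a₀ f) (hg : IsRootsProj b₀ g)
    (hz : ∀ (N : ℕ) [NeZero N], ∃ (k : ℕ) (x : A) (y : B),
      f x = zeta N ∧ N • x = k • a₀ ∧ g y = zeta N ∧ N • y = k • b₀) : Isomorphic A B := by
  choose F hF using hf.exists_matches hg hz
  choose G hG using hg.exists_matches hf (fun N _ => by
    obtain ⟨k, x, y, h₁, h₂, h₃, h₄⟩ := hz N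
    exact ⟨k, y, x, h₃, h₄, h₁, h₂⟩)
  have hu : ∀ {a b}, Matches a₀ b₀ f g a b → F a = b := fun h =>
    (hF _).unique hg hf.zsmul_injective h
  have hu' : ∀ {a b}, Matches a₀ b₀ f g a b → G b = a := fun h =>
    (hG _).unique hf hg.zsmul_injective h.symm
  let Φ : A ≃+ B :=
    { toFun := F
      invFun := G
      left_inv := fun a => hu' (hF a)
      right_inv := fun b => hu (hG b).symm
      map_add' := fun a a' => hu ((hF a).add (hF a')) }
  refine ⟨Φ, fun a b c => ⟨fun h => ?_, fun h => ?_⟩⟩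
  · exact hf.sbtw_map hg (F := Φ.toAddMonoidHom) (fun a => (hF a).1.symm)
      (hu (hf.matches_self hg)) h
  · have := hg.sbtw_map hf (F := Φ.symm.toAddMonoidHom) (fun b => (hG b).1.symm)
      (hu' (hf.matches_self hg)) h
    simpa using this

open FirstOrder Language in
-- The residues at `N` agree once they agree modulo each prime power dividing `N`. For `N = p ^ n *
-- M`, multiplying a lift of `zeta N` by `M` gives a lift of `zeta (p ^ n)`, whose residue is read
-- off from `D_{p^n,r}`.
theorem IsRootsProj.exists_zeta_lifts (hf : IsRootsProj a₀ f) (hg : IsRootsProj b₀ g)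
    (hD : ∀ (p n k : ℕ), p.Prime → 1 ≤ n → k < p ^ n →
      (A ⊨ sentenceD (p ^ n) k ↔ B ⊨ sentenceD (p ^ n) k)) (N : ℕ) [NeZero N] :
    ∃ (k : ℕ) (x : A) (y : B), f x = zeta N ∧ N • x = k • a₀ ∧ g y = zeta N ∧ N • y = k • b₀ := by
  obtain ⟨k, hk, x, hfx, hx⟩ := hf.exists_zeta_lift N
  obtain ⟨l, hl, y, hgy, hy⟩ := hg.exists_zeta_lift N
  suffices h : k ≡ l [MOD N] by
    obtain rfl := h.eq_of_lt_of_lt hk hl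
    exact ⟨k, x, y, hfx, hx, hgy, hy⟩
  rw [← Int.natCast_modEq_iff, Int.modEq_iff_dvd, Int.natCast_dvd, Nat.dvd_iff_prime_pow_dvd_dvd]
  intro p n hp hpn
  rw [← Int.natCast_dvd, ← Int.modEq_iff_dvd, Int.natCast_modEq_iff]
  rcases Nat.eq_zero_or_pos n with rfl | hn
  · rw [pow_zero]
    exact Nat.modEq_one
  have hpn2 : 2 ≤ p ^ n := hp.two_le.trans (Nat.le_self_pow (by omega) _)
  obtain ⟨M, rfl⟩ := hpn
  have i₁ : NeZero (p ^ n) := ⟨by omega⟩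
  have i₂ : NeZero M := ⟨by rintro rfl; exact NeZero.ne _ (mul_zero (p ^ n))⟩
  obtain ⟨r, hr, u, hfu, hu⟩ := hf.exists_zeta_lift (p ^ n)
  have hB := (hD p n r hp hn hr).1 ((hf.realize_sentenceD_iff hpn2 hr).2 ⟨u, hfu, hu⟩)
  obtain ⟨v, hgv, hv⟩ := (hg.realize_sentenceD_iff hpn2 hr).1 hB
  have h₁ := hf.modEq_of_nsmul_eq (x := M • x) (y := u) (N := p ^ n) (k := k) (l := r)
    (by rw [map_nsmul, hfx, nsmul_zeta_mul, hfu]) (by rw [smul_smul, hx, natCast_zsmul])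
    (by rw [hu, natCast_zsmul])
  have h₂ := hg.modEq_of_nsmul_eq (x := M • y) (y := v) (N := p ^ n) (k := l) (l := r)
    (by rw [map_nsmul, hgy, nsmul_zeta_mul, hgv]) (by rw [smul_smul, hy, natCast_zsmul])
    (by rw [hv, natCast_zsmul])
  exact Int.natCast_modEq_iff.1 (h₁.trans h₂.symm)

omit [CyclicallyOrderedAddGroup A] [CyclicallyOrderedAddGroup B] in
theorem Isomorphic.elementarilyEquivalent (h : Isomorphic A B) :
    cogLanguage.ElementarilyEquivalent A B := by
  obtain ⟨F, hF⟩ := h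
  let Φ : cogLanguage.Equiv A B :=
    { F.toEquiv with
      map_fun' := fun {n} s x => by
        cases s with
        | add => exact map_add F (x 0) (x 1)
        | neg => exact map_neg F (x 0)
        | zero => exact map_zero F
      map_rel' := fun {n} s x => by
        cases s with
        | R => exact (hF (x 0) (x 1) (x 2)).symm }
  exact FirstOrder.Language.StrongHomClass.elementarilyEquivalent Φ

end Iso
end CyclicOrd

/-! ### The equivalence of the four conditions -/

open CyclicOrd FirstOrder Language in
theorem mainTheorem10 {C₁ C₂ : Type*}
    [AddCommGroup C₁] [CircularOrder C₁] [CyclicallyOrderedAddGroup C₁]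
    [AddCommGroup C₂] [CircularOrder C₂] [CyclicallyOrderedAddGroup C₂]
    (hna₁ : ¬ CArchimedean C₁) (hna₂ : ¬ CArchimedean C₂)
    (e₁ : C₁) (he₁ : IsFirstPositive e₁) (e₂ : C₂) (he₂ : IsFirstPositive e₂)
    (hU₁ : IsoWith (quotientSBtw (AddSubgroup.zmultiples e₁)) rootsSBtw)
    (hU₂ : IsoWith (quotientSBtw (AddSubgroup.zmultiples e₂)) rootsSBtw) :
    (∃! φ : DigitSequence, IsCharSeq C₁ φ) ∧ (∃! φ : DigitSequence, IsCharSeq C₂ φ) ∧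
    List.TFAE [
      Isomorphic C₁ C₂,
      ∀ (p n k : ℕ), p.Prime → 1 ≤ n → k < p ^ n →
        (C₁ ⊨ sentenceD (p ^ n) k ↔ C₂ ⊨ sentenceD (p ^ n) k),
      cogLanguage.ElementarilyEquivalent C₁ C₂,
      charSeq C₁ = charSeq C₂] := by
  obtain ⟨f₁, hf₁⟩ := exists_isRootsProj he₁ hU₁
  obtain ⟨f₂, hf₂⟩ := exists_isRootsProj he₂ hU₂
  have hφ₁ := hf₁.existsUnique_isCharSeq
  have hφ₂ := hf₂.existsUnique_isCharSeq
  refine ⟨hφ₁, hφ₂, ?_⟩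
  tfae_have 1 → 3 := fun h => h.elementarilyEquivalent
  tfae_have 3 → 2 := fun h p n k _ _ _ => h.realize_sentence _
  tfae_have 2 → 1 := fun h => hf₁.isomorphic hf₂ fun N _ => hf₁.exists_zeta_lifts hf₂ h N
  tfae_have 2 → 4 := fun h => by
    -- `charSeq` is a choice depending only on the predicate, so equal predicates give equal
    -- choices.
    have : IsCharSeq C₁ = IsCharSeq C₂ := by
      funext φ
      refine propext (forall_congr' fun p => forall_congr' fun n => forall_congr' fun hn =>
        forall_congr' fun k => forall_congr' fun hk => ?_)
      rw [h p n k p.2 hn hk]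
    rw [charSeq, charSeq, this]
  tfae_have 4 → 2 := fun h p n k hp hn hk => by
    have h₁ : IsCharSeq C₁ (charSeq C₁) := Classical.epsilon_spec hφ₁.exists
    have h₂ : IsCharSeq C₂ (charSeq C₂) := Classical.epsilon_spec hφ₂.exists
    rw [h₁ ⟨p, hp⟩ n hn k hk, h₂ ⟨p, hp⟩ n hn k hk, h]
  tfae_finish
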